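/- **First-order necessary conditions for minimum-fuel two-impulse interception with the first impulse at the initial time.** Let $\mu>0$, and let $t_0$ and the initial states $(\mathbf r_M(t_0),\mathbf v_M(t_0))$ of an interceptor and $(\mathbf r_T(t_0),\mathbf v_T(t_0))$ of a target in $\mathbb R^3\times\mathbb R^3$ be given. Between impulses both bodies obey $\dot{\mathbf r}=\mathbf v$, $\dot{\mathbf v}=-\frac{\mu}{r^3}\mathbf r$, with $r=|\mathbf r|\neq0$. The interceptor receives an impulse $\Delta\mathbf v_0$ at $t_0$ and an impulse $\Delta\mathbf v_1$ at an unknown time $t_1$: $\mathbf v_M(t_0^+)=\mathbf v_M(t_0)+\Delta\mathbf v_0$ and $\mathbf v_M(t_1^+)=\mathbf v_M(t_1^-)+\Delta\mathbf v_1$, and $\mathbf r_M$ is continuous. It meets the target at an unknown time $t_h$: $\mathbf r_M(t_h)=\mathbf r_T(t_h)$, where $t_0\le t_1\le t_h$. The problem is to minimize $J=|\Delta\mathbf v_0|+|\Delta\mathbf v_1|$ over all such $(\Delta\mathbf v_0,\Delta\mathbf v_1,t_1,t_h)$. Let $(\Delta\mathbf v_0,\Delta\mathbf v_1,t_1,t_h)$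 be a local minimizer (in particular, it may be a global one) with $t_0<t_1$, $\Delta\mathbf v_0\ne0$ and $\Delta\mathbf v_1\neq0$. Assume that the interception constraint is regular there, i.e. the linearization of the miss vector $\mathbf r_M(t_h)-\mathbf r_T(t_h)$ with respect to $(\Delta\mathbf v_0,\Delta\mathbf v_1,t_1,t_h)$, computed from the equations of motion linearized along the trajectory, maps onto $\mathbb R^3$. Then there are costates $(\mathbf p_{Mr1},\mathbf p_{Mv1})$ on $[t_0,t_1]$ and $(\mathbf p_{Mr2},\mathbf p_{Mv2})$ on $[t_1,t_h]$ that satisfy, for $i=1,2$, the adjoint equations $$\dot{\mathbf p}_{Mri}=-\frac{\mu}{r_M^3}\Big(\frac{3}{r_M^2}\mathbf r_M\mathbf r_M^{\mathsf T}-I\Big)\mathbf p_{Mvi},\qquad \dot{\mathbf p}_{Mvi}=-\mathbf p_{Mri},$$ and the boundary conditions 1. $\mathbf p_{Mv1}(t_0^+)+\dfrac{\Delta\mathbf v_0}{|\Delta\mathbf v_0|}=0$, $\ \mathbf p_{Mv1}(t_1^-)+\dfrac{\Delta\mathbf v_1}{|\Delta\mathbf v_1|}=0$, $\ \mathbf p_{Mv1}(t_1^-)-\mathbf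 p_{Mv2}(t_1^+)=0$, $\ \mathbf p_{Mv2}(t_h)=0$, $\ \mathbf p_{Mr1}(t_1^-)-\mathbf p_{Mr2}(t_1^+)=0$; 2. $-\mathbf p_{Mr1}^{\mathsf T}(t_1^-)\,\Delta\mathbf v_1=0$, $\ \mathbf p_{Mr2}^{\mathsf T}(t_h)\big(\mathbf v_M(t_h)-\mathbf v_T(t_h)\big)=0$. -/

import Mathlib

open Set

noncomputable section

/-- Three-dimensional Euclidean space, the space of positions, velocities and costates. -/
abbrev E3 : Type := EuclideanSpace ℝ (Fin 3)

/-- `(r, v)` is a free flight on `[a, b]` in the inverse-square field with gravitational constant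
`μ`: the position avoids the centre of attraction, `r' = v` and `v' = -(μ / ‖r‖³) r` (with
one-sided derivatives at the end points). -/
def IsFreeFlight (μ a b : ℝ) (r v : ℝ → E3) : Prop :=
  ∀ t ∈ Icc a b, r t ≠ 0 ∧
    HasDerivWithinAt r (v t) (Icc a b) t ∧
    HasDerivWithinAt v (-((μ / ‖r t‖ ^ 3) • r t)) (Icc a b) t

/-- The gravity gradient `(μ / r³) (3 r rᵀ / r² - I)` applied to the vector `x`
(recall `r rᵀ x = ⟪r, x⟫ r`). -/
def gravityGradient (μ : ℝ) (r x : E3) : E3 :=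
  (μ / ‖r‖ ^ 3) • ((3 / ‖r‖ ^ 2) • (inner ℝ r x • r) - x)

/-- The adjoint equations along a position history `r` on `[a, b]`:
`p_r' = -(μ / r³) (3 r rᵀ / r² - I) p_v` and `p_v' = -p_r`. -/
def IsCostate (μ a b : ℝ) (r pr pv : ℝ → E3) : Prop :=
  ∀ t ∈ Icc a b,
    HasDerivWithinAt pr (-gravityGradient μ (r t) (pv t)) (Icc a b) t ∧
    HasDerivWithinAt pv (-pr t) (Icc a b) t

/-- The equations of motion linearized along a position history `r` on `[a, b]`:
`ρ' = ν` and `ν' = (μ / r³) (3 r rᵀ / r² - I) ρ`. -/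
def IsLinearizedFlight (μ a b : ℝ) (r ρ ν : ℝ → E3) : Prop :=
  ∀ t ∈ Icc a b,
    HasDerivWithinAt ρ (ν t) (Icc a b) t ∧
    HasDerivWithinAt ν (gravityGradient μ (r t) (ρ t)) (Icc a b) t

/-- The given data: gravitational constant, initial time, and the initial states of the interceptor
(`M`) and of the target (`T`). -/
structure InterceptionData where
  μ : ℝ
  t0 : ℝ
  rM0 : E3
  vM0 : E3
  rT0 : E3
  vT0 : E3

/-- The unknowns: the impulse `dv0` applied at the initial time, the impulse `dv1` applied at
time `t1`, and the impact time `th`. -/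
structure Plan where
  dv0 : E3
  dv1 : E3
  t1 : ℝ
  th : ℝ

/-- The fuel cost `|Δv₀| + |Δv₁|`. -/
def Plan.cost (P : Plan) : ℝ := ‖P.dv0‖ + ‖P.dv1‖

/-- The trajectories realize the plan `P`. The interceptor has state `(rM1, vM1)` on
`[t0, t1]` and `(rM2, vM2)` on `[t1, th]`, so that `vM1 t0`, `vM1 t1`, `vM2 t1` are its velocities
at `t0⁺`, `t1⁻`, `t1⁺`; the target has state `(rT, vT)` on `[t0, th]`. -/
structure IsInterception (D : InterceptionData) (P : Plan)
    (rM1 vM1 rM2 vM2 rT vT : ℝ → E3) : Prop where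
  t0_le_t1 : D.t0 ≤ P.t1
  t1_le_th : P.t1 ≤ P.th
  flight_M1 : IsFreeFlight D.μ D.t0 P.t1 rM1 vM1
  flight_M2 : IsFreeFlight D.μ P.t1 P.th rM2 vM2
  flight_T : IsFreeFlight D.μ D.t0 P.th rT vT
  rM_init : rM1 D.t0 = D.rM0
  vM_init : vM1 D.t0 = D.vM0 + P.dv0
  rM_t1 : rM2 P.t1 = rM1 P.t1
  vM_t1 : vM2 P.t1 = vM1 P.t1 + P.dv1
  rT_init : rT D.t0 = D.rT0
  vT_init : vT D.t0 = D.vT0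
  impact : rM2 P.th - rT P.th = 0

/-- A plan is feasible if it is realized by some trajectories. -/
def IsFeasible (D : InterceptionData) (P : Plan) : Prop :=
  ∃ rM1 vM1 rM2 vM2 rT vT : ℝ → E3, IsInterception D P rM1 vM1 rM2 vM2 rT vT

/-- `P` is a feasible plan that is no more expensive than any feasible plan close to it. -/
def IsLocalOptimum (D : InterceptionData) (P : Plan) : Prop :=
  IsFeasible D P ∧ ∃ ε > 0, ∀ Q : Plan, IsFeasible D Q →
    ‖Q.dv0 - P.dv0‖ < ε → ‖Q.dv1 - P.dv1‖ < ε → |Q.t1 - P.t1| < ε → |Q.th - P.th| < ε →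
    P.cost ≤ Q.cost

/-- Regularity of the interception constraint: every vector `d` is the first-order change of the
miss vector `r_M(th) - r_T(th)` under some first-order changes `a0, a1, s1, sh` of
`Δv₀, Δv₁, t1, th`. Here `(ρ1, ν1)` and `(ρ2, ν2)` are the resulting first-order changes of the
two arcs of the interceptor at fixed time; shifting the impulse by `s1` changes the
second arc's position at `t1` by `-s1 Δv₁`. -/
def IsRegularInterception (D : InterceptionData) (P : Plan)
    (rM1 rM2 vM2 vT : ℝ → E3) : Prop :=
  ∀ d : E3, ∃ (a0 a1 : E3) (s1 sh : ℝ) (ρ1 ν1 ρ2 ν2 : ℝ → E3),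
    IsLinearizedFlight D.μ D.t0 P.t1 rM1 ρ1 ν1 ∧
    IsLinearizedFlight D.μ P.t1 P.th rM2 ρ2 ν2 ∧
    ρ1 D.t0 = 0 ∧ ν1 D.t0 = a0 ∧
    ρ2 P.t1 = ρ1 P.t1 - s1 • P.dv1 ∧ ν2 P.t1 = ν1 P.t1 + a1 ∧
    ρ2 P.th + sh • (vM2 P.th - vT P.th) = d

end

/-! A local optimum minimizes the cost locally on the zero set of the miss vector, which is strictly
differentiable in `(Δv₀, Δv₁, t₁, t_h)` at the optimum. The Lagrange rule gives multipliers `(Λ, Λ₀)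
≠ 0`; regularity excludes `Λ₀ = 0`. After scaling there is a vector `l` with `⟪l, δmiss⟫ + δJ = 0`
for all variations of the plan (`IsInterception.exists_multiplier`).

The costates are the adjoint form of `l`: they are solved backwards from `(l, 0)` at `t_h`,
continuously across `t₁`. Since the gravity gradient is symmetric, `⟪p_r, ρ⟫ + ⟪p_v, ν⟫` is constant
along linearized flights. This turns `⟪l, δmiss⟫` into a linear form in the variations of the four
unknowns (`IsInterception.exists_costates`). The variations are independent, so each of the four
coefficients of `⟪l, δmiss⟫ + δJ` vanishes; these are the stationarity conditions.

The analytic work is the strict differentiability. The field is singular at the centre, so it is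
replaced by a compactly supported `C¹` field that agrees with it near the three compact arcs. The
flow of that field is strictly differentiable in time and initial state
(`IsForwardFlow.hasStrictFDerivAt`), with derivative given by the linearized equations. The
degenerate case `t₁ = t_h` cannot be optimal (`IsLocalOptimum.t1_lt_th`). -/

open Filter Topology
open scoped NNReal

/-! ### Existence for differential equations on a compact interval. -/

/-- Global existence on a compact interval for a bounded Lipschitz time-dependent vector field. -/
theorem exists_hasDerivWithinAt_of_bounded_lipschitz {E : Type*} [NormedAddCommGroup E]
    [NormedSpace ℝ E] [CompleteSpace E] {f : ℝ → E → E} {a b : ℝ} (hab : a ≤ b) {K L : ℝ≥0}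
    (hlip : ∀ t ∈ Icc a b, LipschitzWith K (f t))
    (hcont : ∀ x, ContinuousOn (f · x) (Icc a b))
    (hL : ∀ t ∈ Icc a b, ∀ x, ‖f t x‖ ≤ L) (x₀ : E) :
    ∃ α : ℝ → E, α a = x₀ ∧
      ∀ t ∈ Icc a b, HasDerivWithinAt α (f t (α t)) (Icc a b) t := by
  -- With speed at most `L`, a solution cannot leave the ball of radius `L * (b - a)` in the
  -- available time, so no shrinking of the interval is needed.
  have h : IsPicardLindelof f (⟨a, left_mem_Icc.2 hab⟩ : Icc a b) x₀
      (L * ⟨b - a, sub_nonneg.2 hab⟩) 0 L K :=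
    { lipschitzOnWith := fun t ht => (hlip t ht).lipschitzOnWith
      continuousOn := fun x _ => hcont x
      norm_le := fun t ht x _ => hL t ht x
      mul_max_le := by
        have : max (b - a) 0 = b - a := max_eq_left (sub_nonneg.2 hab)
        simp only [sub_self, this, NNReal.coe_zero, sub_zero]
        exact le_rfl }
  exact h.exists_eq_forall_mem_Icc_hasDerivWithinAt₀

theorem HasDerivWithinAt.Ici_of_Icc {E : Type*} [NormedAddCommGroup E] [NormedSpace ℝ E]
    {f : ℝ → E} {f' : E} {a b t : ℝ} (h : HasDerivWithinAt f f' (Icc a b) t) (ht : t ∈ Ico a b) :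
    HasDerivWithinAt f f' (Ici t) t :=
  h.mono_of_mem_nhdsWithin (Icc_mem_nhdsGE_of_mem ht)

/-- A linear differential equation with continuous coefficients has solutions on the whole
interval. -/
theorem exists_hasDerivWithinAt_linear {E : Type*} [NormedAddCommGroup E]
    [NormedSpace ℝ E] [FiniteDimensional ℝ E] {A : ℝ → E →L[ℝ] E} {a b : ℝ} (hab : a ≤ b)
    (hA : ContinuousOn A (Icc a b)) (x₀ : E) :
    ∃ α : ℝ → E, α a = x₀ ∧
      ∀ t ∈ Icc a b, HasDerivWithinAt α (A t (α t)) (Icc a b) t := by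
  have : CompleteSpace E := FiniteDimensional.complete ℝ E
  obtain ⟨C, hC⟩ := isCompact_Icc.exists_bound_of_continuousOn hA
  have hC0 : 0 ≤ C := (norm_nonneg _).trans (hC a (left_mem_Icc.2 hab))
  -- Grönwall's a priori bound for the linear equation; the `+ 1` makes the bump radius positive
  -- even for `x₀ = 0`.
  set R : ℝ := ‖x₀‖ * Real.exp (C * (b - a)) + 1
  have hR : 0 < R := by positivity
  let χ : ContDiffBump (0 : E) := ⟨R, R + 1, hR, by linarith⟩
  -- A truncated identity makes the field bounded. As `‖g x‖ ≤ ‖x‖`, the truncated equation obeys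
  -- the same a priori bound, so its solution stays where `g` is the identity.
  let g : E → E := fun x => χ x • x
  have hg1 : ContDiff ℝ 1 g := χ.contDiff.smul contDiff_id
  have hgc : HasCompactSupport g := χ.hasCompactSupport.smul_right
  obtain ⟨K, hK⟩ := ContDiff.lipschitzWith_of_hasCompactSupport hgc hg1 one_ne_zero
  obtain ⟨M, hM⟩ := hgc.exists_bound_of_continuous hg1.continuous
  have hM0 : 0 ≤ M := (norm_nonneg _).trans (hM 0)
  obtain ⟨α, hα0, hα⟩ := exists_hasDerivWithinAt_of_bounded_lipschitz (f := fun t x => A t (g x))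
    hab (K := ⟨C, hC0⟩ * K) (L := ⟨C, hC0⟩ * ⟨M, hM0⟩)
    (fun t ht => ((A t).lipschitz.weaken (by exact_mod_cast hC t ht)).comp hK)
    (fun x => hA.clm_apply continuousOn_const)
    (fun t ht x => ((A t).le_opNorm _).trans
      (mul_le_mul (hC t ht) (hM x) (norm_nonneg _) hC0)) x₀
  have hg_le : ∀ x, ‖g x‖ ≤ ‖x‖ := fun x => by
    rw [norm_smul, Real.norm_of_nonneg χ.nonneg]
    exact mul_le_of_le_one_left (norm_nonneg _) χ.le_one
  have hbound : ∀ t ∈ Icc a b, ‖α t‖ ≤ R := by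
    intro t ht
    have h := norm_le_gronwallBound_of_norm_deriv_right_le (δ := ‖x₀‖) (K := C) (ε := 0)
      (HasDerivWithinAt.continuousOn hα)
      (fun s hs => (hα s (Ico_subset_Icc_self hs)).Ici_of_Icc hs) (by rw [hα0])
      (fun s hs => by
        rw [add_zero]
        exact ((A s).le_opNorm _).trans (mul_le_mul (hC s (Ico_subset_Icc_self hs)) (hg_le _)
          (norm_nonneg _) hC0)) t ht
    rw [gronwallBound_ε0] at h
    have h2 : Real.exp (C * (t - a)) ≤ Real.exp (C * (b - a)) :=
      Real.exp_le_exp.2 (mul_le_mul_of_nonneg_left (by linarith [ht.2]) hC0)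
    have h3 := mul_le_mul_of_nonneg_left h2 (norm_nonneg x₀)
    linarith
  refine ⟨α, hα0, fun t ht => ?_⟩
  have h1 : g (α t) = α t := by
    have : χ (α t) = 1 := χ.one_of_mem_closedBall (by simpa using hbound t ht)
    simp [g, this]
  simpa only [h1] using hα t ht

/-! ### The forward flow of a Lipschitz vector field. -/

/-- Solutions on `[0, B]` depend on the initial point in a Lipschitz way, uniformly in time. -/
theorem dist_le_exp_mul_of_hasDerivWithinAt {E : Type*} [NormedAddCommGroup E] [NormedSpace ℝ E]
    {f : E → E} {K : ℝ≥0} (hf : LipschitzWith K f) {B : ℝ} {x y : ℝ → E}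
    (hx : ∀ t ∈ Icc 0 B, HasDerivWithinAt x (f (x t)) (Icc 0 B) t)
    (hy : ∀ t ∈ Icc 0 B, HasDerivWithinAt y (f (y t)) (Icc 0 B) t) {t : ℝ} (ht : t ∈ Icc 0 B) :
    dist (x t) (y t) ≤ Real.exp (K * B) * dist (x 0) (y 0) := by
  refine (dist_le_of_trajectories_ODE (v := fun _ => f) (K := K) (fun _ => hf)
    (HasDerivWithinAt.continuousOn hx)
    (fun s hs => (hx s (Ico_subset_Icc_self hs)).Ici_of_Icc hs)
    (HasDerivWithinAt.continuousOn hy)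
    (fun s hs => (hy s (Ico_subset_Icc_self hs)).Ici_of_Icc hs) le_rfl t ht).trans ?_
  rw [mul_comm]
  refine mul_le_mul_of_nonneg_right ?_ dist_nonneg
  exact Real.exp_le_exp.2 (mul_le_mul_of_nonneg_left (by simpa using ht.2) K.2)

/-- `φ` is the forward flow of the autonomous vector field `f` for times in `[0, B]`. -/
structure IsForwardFlow {E : Type*} [NormedAddCommGroup E] [NormedSpace ℝ E]
    (f : E → E) (B : ℝ) (φ : E → ℝ → E) : Prop where
  init : ∀ x, φ x 0 = x
  deriv : ∀ x, ∀ t ∈ Icc 0 B, HasDerivWithinAt (φ x) (f (φ x t)) (Icc 0 B) t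
  continuous : Continuous fun p : E × ℝ => φ p.1 p.2

theorem exists_isForwardFlow {E : Type*} [NormedAddCommGroup E] [NormedSpace ℝ E]
    [CompleteSpace E] {f : E → E} {K L : ℝ≥0} (hf : LipschitzWith K f) (hL : ∀ x, ‖f x‖ ≤ L)
    {B : ℝ} (hB : 0 ≤ B) : ∃ φ : E → ℝ → E, IsForwardFlow f B φ := by
  choose α hα0 hα using exists_hasDerivWithinAt_of_bounded_lipschitz (f := fun _ => f) hB
    (fun _ _ => hf) (fun _ => continuousOn_const) (fun _ _ => hL)
  have hproj : ∀ x, ∀ t ∈ Icc 0 B, α x (projIcc 0 B hB t) = α x t := fun x t ht => by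
    rw [projIcc_of_mem hB ht]
  -- Freezing the time outside `[0, B]` makes the flow jointly continuous on all of `E × ℝ`.
  refine ⟨fun x t => α x (projIcc 0 B hB t), fun x => by simp [hα0], fun x t ht => ?_, ?_⟩
  · simp only [hproj x t ht]
    exact (hα x t ht).congr_of_mem (hproj x) ht
  · refine continuous_prod_of_continuous_lipschitzWith _
      ⟨Real.exp (K * B), (Real.exp_pos _).le⟩ (fun x => ?_) (fun t => ?_)
    · exact (HasDerivWithinAt.continuousOn (hα x)).comp_continuous
        (continuous_subtype_val.comp continuous_projIcc) (fun t => (projIcc 0 B hB t).2)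
    · refine LipschitzWith.of_dist_le_mul fun x y => ?_
      have h := dist_le_exp_mul_of_hasDerivWithinAt hf (hα x) (hα y) (projIcc 0 B hB t).2
      rwa [hα0, hα0] at h

theorem IsForwardFlow.dist_le {E : Type*} [NormedAddCommGroup E] [NormedSpace ℝ E]
    {f : E → E} {B : ℝ} {φ : E → ℝ → E} (hφ : IsForwardFlow f B φ) {K : ℝ≥0}
    (hf : LipschitzWith K f) (x y : E) {t : ℝ} (ht : t ∈ Icc 0 B) :
    dist (φ x t) (φ y t) ≤ Real.exp (K * B) * dist x y := by
  simpa only [hφ.init] using dist_le_exp_mul_of_hasDerivWithinAt hf (hφ.deriv x) (hφ.deriv y) ht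

/-- A curve that solves the differential equation follows the forward flow. -/
theorem IsForwardFlow.eq_of_hasDerivWithinAt {E : Type*} [NormedAddCommGroup E] [NormedSpace ℝ E]
    {f : E → E} {B : ℝ} {φ : E → ℝ → E} (hφ : IsForwardFlow f B φ) {K : ℝ≥0}
    (hf : LipschitzWith K f) {a b : ℝ} (hB : b - a ≤ B) {x : ℝ → E}
    (hx : ∀ t ∈ Icc a b, HasDerivWithinAt x (f (x t)) (Icc a b) t) :
    ∀ t ∈ Icc a b, φ (x a) (t - a) = x t := by
  have hmaps : MapsTo (fun t => t - a) (Icc a b) (Icc 0 B) := fun t ht =>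
    ⟨by linarith [ht.1], by linarith [ht.2]⟩
  have hd : ∀ t ∈ Icc a b, HasDerivWithinAt (fun t => φ (x a) (t - a)) (f (φ (x a) (t - a)))
      (Icc a b) t := fun t ht => by
    simpa [Function.comp_def] using (hφ.deriv (x a) (t - a) (hmaps ht)).scomp t
      ((hasDerivWithinAt_id t _).sub_const a) hmaps
  exact ODE_solution_unique (v := fun _ => f) (fun _ => hf)
    (HasDerivWithinAt.continuousOn hd)
    (fun s hs => (hd s (Ico_subset_Icc_self hs)).Ici_of_Icc hs)
    (HasDerivWithinAt.continuousOn hx)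
    (fun s hs => (hx s (Ico_subset_Icc_self hs)).Ici_of_Icc hs)
    (by simp [hφ.init])

theorem IsForwardFlow.continuous_apply {E : Type*} [NormedAddCommGroup E] [NormedSpace ℝ E]
    {f : E → E} {B : ℝ} {φ : E → ℝ → E} (hφ : IsForwardFlow f B φ) (x : E) : Continuous (φ x) :=
  hφ.continuous.comp (continuous_const.prodMk continuous_id)

/-- A trajectory that stays in an open set until time `T` does so for all nearby initial points
and final times. -/
theorem IsForwardFlow.eventually_mem {E : Type*} [NormedAddCommGroup E] [NormedSpace ℝ E]
    {f : E → E} {B : ℝ} {φ : E → ℝ → E} (hφ : IsForwardFlow f B φ) {U : Set E} (hU : IsOpen U)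
    {x : E} {T : ℝ} (hT : 0 ≤ T) (hx : ∀ t ∈ Icc 0 T, φ x t ∈ U) :
    ∀ᶠ p : ℝ × E in 𝓝 (T, x), ∀ t ∈ Icc 0 p.1, φ p.2 t ∈ U := by
  -- Rescaling time to `θ ∈ [0, 1]` gives a compact set that does not depend on the final time, as
  -- the tube argument requires.
  have h : ∀ᶠ p : ℝ × E in 𝓝 (T, x), ∀ θ ∈ Icc (0 : ℝ) 1, φ p.2 (θ * p.1) ∈ U := by
    refine isCompact_Icc.eventually_forall_of_forall_eventually fun θ hθ => ?_
    have hc : Continuous fun z : (ℝ × E) × ℝ => φ z.1.2 (z.2 * z.1.1) :=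
      hφ.continuous.comp (by fun_prop : Continuous fun z : (ℝ × E) × ℝ => (z.1.2, z.2 * z.1.1))
    exact hc.continuousAt.eventually_mem (hU.mem_nhds
      (hx _ ⟨mul_nonneg hθ.1 hT, mul_le_of_le_one_left hT hθ.2⟩))
  filter_upwards [h] with p hp t ht
  rcases (ht.1.trans ht.2).eq_or_lt with h0 | h0
  · have : t = 0 := le_antisymm (h0 ▸ ht.2) ht.1
    simpa [this] using hp 0 (by simp)
  · have := hp (t / p.1) ⟨div_nonneg ht.1 h0.le, (div_le_one h0).2 ht.2⟩
    rwa [div_mul_cancel₀ _ h0.ne'] at this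

/-! ### Strict differentiability of the flow. -/

/-- Along a curve of centres, a vector field with uniformly continuous derivative is uniformly
strictly differentiable. -/
theorem exists_forall_norm_sub_sub_le {E : Type*} [NormedAddCommGroup E] [NormedSpace ℝ E]
    {f : E → E} {f' : E → E →L[ℝ] E} (hf : ∀ x, HasFDerivAt f (f' x) x)
    (hf' : UniformContinuous f') {ε : ℝ} (hε : 0 < ε) :
    ∃ δ > 0, ∀ c u w, dist u c < δ → dist w c < δ →
      ‖f u - f w - f' c (u - w)‖ ≤ ε * ‖u - w‖ := by
  obtain ⟨δ, hδ, h⟩ := Metric.uniformContinuous_iff.1 hf' ε hε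
  refine ⟨δ, hδ, fun c u w hu hw => ?_⟩
  refine (convex_ball c δ).norm_image_sub_le_of_norm_hasFDerivWithin_le'
    (fun x _ => (hf x).hasFDerivWithinAt) (fun x hx => ?_) hw hu
  rw [← dist_eq_norm]
  exact (h hx).le

/-- The forward flow is differentiable in the initial point, strictly and uniformly in time; the
derivative solves the linearized equation. -/
theorem IsForwardFlow.exists_forall_norm_sub_sub_le {E : Type*} [NormedAddCommGroup E]
    [NormedSpace ℝ E] {f : E → E} {B : ℝ} {φ : E → ℝ → E} (hφ : IsForwardFlow f B φ)
    {f' : E → E →L[ℝ] E} (hf : ∀ x, HasFDerivAt f (f' x) x) (hf' : UniformContinuous f')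
    {K : ℝ≥0} (hK : LipschitzWith K f) {x₀ : E} {Φ : ℝ → E →L[ℝ] E}
    (hΦ0 : Φ 0 = ContinuousLinearMap.id ℝ E)
    (hΦ : ∀ t ∈ Icc 0 B, HasDerivWithinAt Φ (f' (φ x₀ t) ∘L Φ t) (Icc 0 B) t)
    {ε : ℝ} (hε : 0 < ε) :
    ∃ δ > 0, ∀ x y, dist x x₀ < δ → dist y x₀ < δ → ∀ t ∈ Icc 0 B,
      ‖φ x t - φ y t - Φ t (x - y)‖ ≤ ε * ‖x - y‖ := by
  set M := Real.exp (K * B)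
  have hM : 0 < M := Real.exp_pos _
  set G := gronwallBound 0 K 1 B
  -- The linearization remainder is at most `η * (M * ‖x - y‖)`, and Grönwall multiplies it by at
  -- most `G`; `|G| + 1` avoids a zero divisor.
  obtain ⟨η, hη, hηε⟩ : ∃ η > 0, η * (M * (|G| + 1)) = ε :=
    ⟨ε / (M * (|G| + 1)), by positivity, by field_simp⟩
  obtain ⟨δ, hδ, h⟩ := _root_.exists_forall_norm_sub_sub_le hf hf' hη
  refine ⟨δ / M, by positivity, fun x y hx hy t ht => ?_⟩
  have hclose : ∀ z, dist z x₀ < δ / M → ∀ s ∈ Icc 0 B, dist (φ z s) (φ x₀ s) < δ :=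
    fun z hz s hs => by
      have := hφ.dist_le hK z x₀ hs
      rw [lt_div_iff₀ hM, mul_comm] at hz
      exact this.trans_lt hz
  have hder : ∀ s ∈ Icc 0 B, HasDerivWithinAt (fun s => φ x s - φ y s - Φ s (x - y))
      (f (φ x s) - f (φ y s) - f' (φ x₀ s) (Φ s (x - y))) (Icc 0 B) s := fun s hs => by
    have := (hΦ s hs).clm_apply (hasDerivWithinAt_const s (Icc 0 B) (x - y))
    simpa using ((hφ.deriv x s hs).fun_sub (hφ.deriv y s hs)).fun_sub this
  have hf'K : ∀ z, ‖f' z‖ ≤ K := fun z => (hf z).le_of_lipschitz hK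
  have key := norm_le_gronwallBound_of_norm_deriv_right_le (δ := 0) (K := K)
    (ε := η * (M * ‖x - y‖)) (HasDerivWithinAt.continuousOn hder)
    (fun s hs => (hder s (Ico_subset_Icc_self hs)).Ici_of_Icc hs)
    (by simp [hφ.init, hΦ0]) (fun s hs => ?_) t ht
  · refine key.trans ?_
    have hlin : ∀ e, gronwallBound 0 K e (t - 0) = e * gronwallBound 0 K 1 t := fun e => by
      unfold gronwallBound
      split_ifs <;> simp; ring
    have hmono : gronwallBound 0 K 1 t ≤ |G| + 1 := by
      have : gronwallBound 0 K 1 t ≤ G := gronwallBound_mono le_rfl zero_le_one K.2 ht.2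
      have h2 := le_abs_self G
      linarith
    rw [hlin, ← hηε]
    calc η * (M * ‖x - y‖) * gronwallBound 0 K 1 t ≤ η * (M * ‖x - y‖) * (|G| + 1) := by gcongr
      _ = _ := by ring
  · have hs' := Ico_subset_Icc_self hs
    -- The linearized field applied to the error, plus the remainder of `f` at the centre `φ x₀ s`:
    -- the form Grönwall needs.
    have e : f (φ x s) - f (φ y s) - f' (φ x₀ s) (Φ s (x - y)) =
        f' (φ x₀ s) (φ x s - φ y s - Φ s (x - y)) +
          (f (φ x s) - f (φ y s) - f' (φ x₀ s) (φ x s - φ y s)) := by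
      rw [map_sub (f' (φ x₀ s)) (φ x s - φ y s)]
      abel
    rw [e]
    refine (norm_add_le _ _).trans (add_le_add ?_ ?_)
    · exact ((f' (φ x₀ s)).le_opNorm _).trans (mul_le_mul_of_nonneg_right (hf'K _) (norm_nonneg _))
    · refine (h _ _ _ (hclose x hx s hs') (hclose y hy s hs')).trans ?_
      have := hφ.dist_le hK x y hs'
      rw [dist_eq_norm, dist_eq_norm] at this
      gcongr

/-- The forward flow is strictly differentiable in time and initial point. -/
theorem IsForwardFlow.hasStrictFDerivAt {E : Type*} [NormedAddCommGroup E]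
    [NormedSpace ℝ E] {f : E → E} {B : ℝ} {φ : E → ℝ → E} (hφ : IsForwardFlow f B φ)
    {f' : E → E →L[ℝ] E} (hf : ∀ x, HasFDerivAt f (f' x) x) (hf' : UniformContinuous f')
    {K : ℝ≥0} (hK : LipschitzWith K f) {x₀ : E} {Φ : ℝ → E →L[ℝ] E}
    (hΦ0 : Φ 0 = ContinuousLinearMap.id ℝ E)
    (hΦ : ∀ t ∈ Icc 0 B, HasDerivWithinAt Φ (f' (φ x₀ t) ∘L Φ t) (Icc 0 B) t)
    {T : ℝ} (hT : T ∈ Ioo 0 B) :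
    HasStrictFDerivAt (fun p : ℝ × E => φ p.2 p.1)
      ((ContinuousLinearMap.toSpanSingleton ℝ (f (φ x₀ T))).coprod (Φ T)) (T, x₀) := by
  rw [hasStrictFDerivAt_iff_isLittleO, Asymptotics.isLittleO_iff]
  intro ε hε
  have hε3 : 0 < ε / 3 := by positivity
  obtain ⟨δ, hδ, hx⟩ := hφ.exists_forall_norm_sub_sub_le hf hf' hK hΦ0 hΦ hε3
  have hΦc : ContinuousAt Φ T :=
    (HasDerivWithinAt.continuousOn hΦ).continuousAt (Icc_mem_nhds hT.1 hT.2)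
  have hfc : ContinuousAt (fun p : ℝ × E => f (φ p.2 p.1)) (T, x₀) :=
    (hK.continuous.comp (hφ.continuous.comp continuous_swap)).continuousAt
  have e1 : ∀ᶠ p : ℝ × E in 𝓝 (T, x₀), ‖Φ p.1 - Φ T‖ ≤ ε / 3 := by
    have h := (hΦc.tendsto.comp (continuous_fst.tendsto (T, x₀))).eventually
      (Metric.closedBall_mem_nhds _ hε3)
    filter_upwards [h] with p hp using by simpa [dist_eq_norm] using hp
  obtain ⟨r, hr, hball⟩ : ∃ r > 0, ∀ p ∈ Metric.ball (T, x₀) r,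
      ‖Φ p.1 - Φ T‖ ≤ ε / 3 ∧ ‖f (φ p.2 p.1) - f (φ x₀ T)‖ ≤ ε / 3 ∧ p.1 ∈ Ioo 0 B ∧
        dist p.2 x₀ < δ := by
    refine Metric.eventually_nhds_iff_ball.1 (e1.and (.and ?_ (.and ?_ ?_)))
    · filter_upwards [hfc.eventually (Metric.closedBall_mem_nhds _ hε3)] with p hp
      simpa [dist_eq_norm] using hp
    · exact (continuous_fst.tendsto (T, x₀)).eventually (Ioo_mem_nhds hT.1 hT.2)
    · exact (continuous_snd.tendsto (T, x₀)).eventually (Metric.ball_mem_nhds _ hδ)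
  have hnhds : Metric.ball ((T, x₀), (T, x₀)) r ∈ 𝓝 ((T, x₀), (T, x₀)) := Metric.ball_mem_nhds _ hr
  filter_upwards [hnhds] with ⟨⟨t, x⟩, ⟨s, y⟩⟩ hp
  rw [Metric.mem_ball, Prod.dist_eq, max_lt_iff] at hp
  obtain ⟨hp1, hp2⟩ := hp
  obtain ⟨h1, -, h3, h4⟩ := hball _ hp1
  obtain ⟨-, -, h3', h4'⟩ := hball _ hp2
  rw [Prod.dist_eq, max_lt_iff] at hp1 hp2
  dsimp only at *
  -- Mean value inequality in time; the intersection with the ball keeps the velocity within `ε / 3`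
  -- of `f (φ x₀ T)`.
  have hseg : ‖φ y t - φ y s - (t - s) • f (φ x₀ T)‖ ≤ ε / 3 * ‖t - s‖ := by
    have hconv : Convex ℝ (Metric.ball T r ∩ Ioo 0 B) := (convex_ball T r).inter (convex_Ioo 0 B)
    have hg : ∀ τ ∈ Metric.ball T r ∩ Ioo 0 B, HasDerivWithinAt
        (fun τ => φ y τ - τ • f (φ x₀ T)) (f (φ y τ) - f (φ x₀ T)) (Metric.ball T r ∩ Ioo 0 B) τ :=
      fun τ hτ => by
        have hd := (hφ.deriv y τ (Ioo_subset_Icc_self hτ.2)).mono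
          (inter_subset_right.trans Ioo_subset_Icc_self : Metric.ball T r ∩ Ioo 0 B ⊆ Icc 0 B)
        simpa using hd.fun_sub ((hasDerivWithinAt_id τ _).smul_const (f (φ x₀ T)))
    have := hconv.norm_image_sub_le_of_norm_hasDerivWithin_le hg (C := ε / 3)
      (fun τ hτ => (hball (τ, y) (by
        rw [Metric.mem_ball, Prod.dist_eq, max_lt_iff]
        exact ⟨hτ.1, hp2.2⟩)).2.1) ⟨hp2.1, h3'⟩ ⟨hp1.1, h3⟩
    refine le_of_eq_of_le (congrArg _ ?_) this
    module
  have hxy := hx x y h4 h4' t (Ioo_subset_Icc_self h3)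
  have hΦt : ‖(Φ t - Φ T) (x - y)‖ ≤ ε / 3 * ‖x - y‖ :=
    ((Φ t - Φ T).le_opNorm _).trans (mul_le_mul_of_nonneg_right h1 (norm_nonneg _))
  have hn1 : ‖t - s‖ ≤ ‖((t, x) - (s, y) : ℝ × E)‖ := norm_fst_le ((t, x) - (s, y) : ℝ × E)
  have hn2 : ‖x - y‖ ≤ ‖((t, x) - (s, y) : ℝ × E)‖ := norm_snd_le ((t, x) - (s, y) : ℝ × E)
  -- Three errors of size `ε / 3`: change of initial point at time `t`, change of time along `y`,
  -- and replacement of `Φ t` by `Φ T`.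
  have e : φ x t - φ y s - ((ContinuousLinearMap.toSpanSingleton ℝ (f (φ x₀ T))).coprod (Φ T))
      ((t, x) - (s, y)) = (φ x t - φ y t - Φ t (x - y)) + (φ y t - φ y s - (t - s) • f (φ x₀ T)) +
        (Φ t - Φ T) (x - y) := by
    simp
    abel
  rw [e]
  refine (norm_add₃_le).trans ?_
  nlinarith

/-! ### Truncation, and the gravity field with its linearization. -/

/-- A function that is `C¹` on a neighbourhood of a compact set agrees near that set with a
compactly supported `C¹` function. -/
theorem exists_contDiff_hasCompactSupport_eqOn {E F : Type*} [NormedAddCommGroup E]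
    [NormedSpace ℝ E] [FiniteDimensional ℝ E] [NormedAddCommGroup F] [NormedSpace ℝ F]
    {f : E → F} {C V : Set E} (hC : IsCompact C) (hV : IsOpen V) (hCV : C ⊆ V)
    (hf : ContDiffOn ℝ 1 f V) :
    ∃ (g : E → F) (U : Set E), ContDiff ℝ 1 g ∧ HasCompactSupport g ∧ IsOpen U ∧ C ⊆ U ∧ U ⊆ V ∧
      EqOn g f U := by
  obtain ⟨t, ht, hCt, htV⟩ := exists_compact_between hC hV hCV
  obtain ⟨χ, h1, h0, -⟩ := exists_contMDiffMap_one_nhds_of_subset_interior (n := 1)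
    (modelWithCornersSelf ℝ E) hC.isClosed hCt
  obtain ⟨W, hW, hCW, hW1⟩ := mem_nhdsSet_iff_exists.1 h1
  have hχ : ContDiff ℝ 1 χ := χ.contMDiff.contDiff
  refine ⟨fun x => χ x • f x, W ∩ V, contDiff_iff_contDiffAt.2 fun x => ?_, ?_, hW.inter hV,
    subset_inter hCW hCV, inter_subset_right, fun x hx => ?_⟩
  -- Off `V` the cutoff vanishes in a whole neighbourhood, since its support lies in the closed set
  -- `t ⊆ V`; the values of `f` there do not matter.
  · by_cases hx : x ∈ V
    · exact hχ.contDiffAt.smul (hf.contDiffAt (hV.mem_nhds hx))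
    · refine (contDiffAt_const (c := (0 : F))).congr_of_eventuallyEq ?_
      filter_upwards [ht.isClosed.isOpen_compl.mem_nhds fun h => hx (htV h)] with y hy
      simp [h0 y hy]
  · refine HasCompactSupport.intro ht fun x hx => ?_
    simp [h0 x hx]
  · have : χ x = 1 := hW1 hx.1
    simp [this]

theorem hasStrictFDerivAt_norm_of_ne_zero {E : Type*} [NormedAddCommGroup E]
    [InnerProductSpace ℝ E] {x : E} (hx : x ≠ 0) :
    HasStrictFDerivAt (fun x : E => ‖x‖) (‖x‖⁻¹ • innerSL ℝ x) x := by
  have hn : ‖x‖ ≠ 0 := norm_ne_zero_iff.2 hx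
  have h := (hasStrictFDerivAt_norm_sq x).sqrt (by positivity)
  simp only [Real.sqrt_sq (norm_nonneg _)] at h
  refine h.congr_fderiv ?_
  ext y
  simp
  field_simp

/-- The gravity gradient as a continuous linear map. -/
noncomputable def gravityGradientL (μ : ℝ) (r : E3) : E3 →L[ℝ] E3 :=
  (μ / ‖r‖ ^ 3) • ((3 / ‖r‖ ^ 2) • (innerSL ℝ r).smulRight r - ContinuousLinearMap.id ℝ E3)

@[simp]
theorem gravityGradientL_apply (μ : ℝ) (r x : E3) :
    gravityGradientL μ r x = gravityGradient μ r x := rfl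

/-- The gravity gradient is symmetric. -/
theorem inner_gravityGradient_comm (μ : ℝ) (r x y : E3) :
    inner ℝ (gravityGradient μ r x) y = inner ℝ x (gravityGradient μ r y) := by
  simp only [gravityGradient, inner_smul_left, inner_smul_right, inner_sub_left, inner_sub_right,
    conj_trivial, real_inner_comm r x]
  ring

/-- The gravity gradient is the derivative of the gravitational acceleration. -/
theorem hasFDerivAt_gravity (μ : ℝ) {r : E3} (hr : r ≠ 0) :
    HasFDerivAt (fun r : E3 => -((μ / ‖r‖ ^ 3) • r)) (gravityGradientL μ r) r := by
  have hn : ‖r‖ ≠ 0 := norm_ne_zero_iff.2 hr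
  have h2 : HasFDerivAt (fun r : E3 => μ / ‖r‖ ^ 3)
      ((-(3 * μ / ‖r‖ ^ 5)) • innerSL ℝ r) r := by
    have hd : HasDerivAt (fun x : ℝ => μ / x ^ 3) (-(3 * μ / ‖r‖ ^ 4)) ‖r‖ := by
      have := ((hasDerivAt_pow 3 ‖r‖).inv (pow_ne_zero 3 hn)).const_mul μ
      refine this.congr_deriv ?_
      simp
      field_simp
    refine (hd.comp_hasFDerivAt r (hasStrictFDerivAt_norm_of_ne_zero hr).hasFDerivAt).congr_fderiv ?_
    rw [smul_smul]
    congr 1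
    field_simp
  refine (h2.smul (hasFDerivAt_id r)).neg.congr_fderiv ?_
  ext1 x
  simp only [gravityGradientL_apply, gravityGradient, id, neg_apply, add_apply,
    smul_apply, ContinuousLinearMap.smulRight_apply, ContinuousLinearMap.id_apply, innerSL_apply_apply,
    smul_eq_mul]
  have e : 3 * μ / ‖r‖ ^ 5 = μ / ‖r‖ ^ 3 * (3 / ‖r‖ ^ 2) := by field_simp
  rw [e]
  module

/-- The vector field `(r, v) ↦ (v, -(μ / ‖r‖³) r)` of the equations of motion. -/
noncomputable def flightField (μ : ℝ) (x : E3 × E3) : E3 × E3 := (x.2, -((μ / ‖x.1‖ ^ 3) • x.1))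

/-- The linearized equations of motion `(ρ, ν) ↦ (ν, G(r) ρ)`. -/
noncomputable def linearizedField (μ : ℝ) (r : E3) : E3 × E3 →L[ℝ] E3 × E3 :=
  (ContinuousLinearMap.snd ℝ E3 E3).prod
    ((gravityGradientL μ r).comp (ContinuousLinearMap.fst ℝ E3 E3))

theorem hasFDerivAt_flightField (μ : ℝ) {x : E3 × E3} (hx : x.1 ≠ 0) :
    HasFDerivAt (flightField μ) (linearizedField μ x.1) x :=
  hasFDerivAt_snd.prodMk ((hasFDerivAt_gravity μ hx).comp x hasFDerivAt_fst)

theorem contDiffOn_flightField (μ : ℝ) :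
    ContDiffOn ℝ 1 (flightField μ) {x : E3 × E3 | x.1 ≠ 0} := by
  intro x hx
  have hn : ContDiffAt ℝ 1 (fun x : E3 × E3 => ‖x.1‖) x :=
    (contDiffAt_norm ℝ hx).comp x contDiffAt_fst
  have hp : ‖x.1‖ ^ 3 ≠ 0 := pow_ne_zero 3 (norm_ne_zero_iff.2 hx)
  exact (contDiffAt_snd.prodMk
    (((contDiffAt_const.div (hn.pow 3) hp).smul contDiffAt_fst).neg)).contDiffWithinAt

theorem isOpen_fst_ne_zero : IsOpen {x : E3 × E3 | x.1 ≠ 0} :=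
  isOpen_ne_fun continuous_fst continuous_const

theorem hasDerivWithinAt_prodMk_iff {E F : Type*} [NormedAddCommGroup E] [NormedSpace ℝ E]
    [NormedAddCommGroup F] [NormedSpace ℝ F] {x : ℝ → E} {y : ℝ → F} {x' : E} {y' : F}
    {s : Set ℝ} {t : ℝ} :
    HasDerivWithinAt (fun t => (x t, y t)) (x', y') s t ↔
      HasDerivWithinAt x x' s t ∧ HasDerivWithinAt y y' s t :=
  ⟨fun h => ⟨by simpa using h.hasFDerivWithinAt.fst.hasDerivWithinAt,
    by simpa using h.hasFDerivWithinAt.snd.hasDerivWithinAt⟩, fun h => h.1.prodMk h.2⟩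

theorem IsFreeFlight.hasDerivWithinAt {μ a b : ℝ} {r v : ℝ → E3} (h : IsFreeFlight μ a b r v) :
    ∀ t ∈ Icc a b,
      HasDerivWithinAt (fun t => (r t, v t)) (flightField μ (r t, v t)) (Icc a b) t :=
  fun t ht => (h t ht).2.1.prodMk (h t ht).2.2

theorem IsFreeFlight.continuousOn {μ a b : ℝ} {r v : ℝ → E3} (h : IsFreeFlight μ a b r v) :
    ContinuousOn (fun t => (r t, v t)) (Icc a b) :=
  HasDerivWithinAt.continuousOn h.hasDerivWithinAt

theorem continuousOn_gravityGradientL {μ a b : ℝ} {r : ℝ → E3} (hr : ContinuousOn r (Icc a b))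
    (h0 : ∀ t ∈ Icc a b, r t ≠ 0) : ContinuousOn (fun t => gravityGradientL μ (r t)) (Icc a b) := by
  have hn : ∀ k : ℕ, ∀ t ∈ Icc a b, ‖r t‖ ^ k ≠ 0 := fun k t ht =>
    pow_ne_zero k (norm_ne_zero_iff.2 (h0 t ht))
  unfold gravityGradientL
  refine (continuousOn_const.div (hr.norm.pow 3) (hn 3)).smul (.sub (.smul
    (continuousOn_const.div (hr.norm.pow 2) (hn 2)) ?_) continuousOn_const)
  exact (((ContinuousLinearMap.smulRightL ℝ E3 E3).continuous.comp
    (innerSL ℝ).continuous).comp_continuousOn hr).clm_apply hr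

theorem exists_isLinearizedFlight {μ a b : ℝ} (hab : a ≤ b) {r : ℝ → E3}
    (hr : ContinuousOn r (Icc a b)) (h0 : ∀ t ∈ Icc a b, r t ≠ 0) (ρ₀ ν₀ : E3) :
    ∃ ρ ν : ℝ → E3, IsLinearizedFlight μ a b r ρ ν ∧ ρ a = ρ₀ ∧ ν a = ν₀ := by
  have hA : ContinuousOn (fun t => linearizedField μ (r t)) (Icc a b) :=
    (ContinuousLinearMap.prodₗᵢ ℝ (𝕜 := ℝ) (E := E3 × E3) (F := E3)
      (G := E3)).continuous.comp_continuousOn (continuousOn_const.prodMk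
        ((continuousOn_gravityGradientL hr h0).clm_comp continuousOn_const))
  obtain ⟨α, hα0, hα⟩ := exists_hasDerivWithinAt_linear hab hA (ρ₀, ν₀)
  exact ⟨fun t => (α t).1, fun t => (α t).2, fun t ht => hasDerivWithinAt_prodMk_iff.1 (hα t ht),
    by simp [hα0], by simp [hα0]⟩

/-! ### Costates and their duality with linearized flights. -/

/-- Costates with prescribed terminal values exist; they are the time-reversed linearized
flights. -/
theorem exists_isCostate {μ a b : ℝ} (hab : a ≤ b) {r : ℝ → E3}
    (hr : ContinuousOn r (Icc a b)) (h0 : ∀ t ∈ Icc a b, r t ≠ 0) (pr₁ pv₁ : E3) :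
    ∃ pr pv : ℝ → E3, IsCostate μ a b r pr pv ∧ pr b = pr₁ ∧ pv b = pv₁ := by
  have hmaps : MapsTo (fun t => a + b - t) (Icc a b) (Icc a b) := fun t ht =>
    ⟨by linarith [ht.2], by linarith [ht.1]⟩
  have hrev : ContinuousOn (fun t => r (a + b - t)) (Icc a b) :=
    hr.comp (by fun_prop) hmaps
  obtain ⟨ρ, ν, h, hρ, hν⟩ := exists_isLinearizedFlight (μ := μ) hab hrev
    (fun t ht => h0 _ (hmaps ht)) pv₁ pr₁
  refine ⟨fun t => ν (a + b - t), fun t => ρ (a + b - t), fun t ht => ?_, by simpa, by simpa⟩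
  have hd : HasDerivWithinAt (fun t => a + b - t) (-1) (Icc a b) t := by
    simpa using (hasDerivWithinAt_id t (Icc a b)).const_sub (a + b)
  obtain ⟨h1, h2⟩ := h _ (hmaps ht)
  constructor
  · simpa [Function.comp_def] using h2.scomp t hd hmaps
  · simpa [Function.comp_def] using h1.scomp t hd hmaps

/-- The pairing of a costate with a linearized flight is constant. -/
theorem IsCostate.inner_add_inner_eq {μ a b : ℝ} (hab : a ≤ b) {r pr pv ρ ν : ℝ → E3}
    (hp : IsCostate μ a b r pr pv) (hρ : IsLinearizedFlight μ a b r ρ ν) :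
    inner ℝ (pr b) (ρ b) + inner ℝ (pv b) (ν b) = inner ℝ (pr a) (ρ a) + inner ℝ (pv a) (ν a) := by
  have hd : ∀ t ∈ Icc a b, HasDerivWithinAt (fun t => inner ℝ (pr t) (ρ t) + inner ℝ (pv t) (ν t))
      0 (Icc a b) t := fun t ht => by
    have h := ((hp t ht).1.inner ℝ (hρ t ht).1).add ((hp t ht).2.inner ℝ (hρ t ht).2)
    refine h.congr_deriv ?_
    rw [inner_neg_left, inner_neg_left, inner_gravityGradient_comm]
    ring
  exact constant_of_has_deriv_right_zero (HasDerivWithinAt.continuousOn hd)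
    (fun t ht => (hd t (Ico_subset_Icc_self ht)).Ici_of_Icc ht) b (right_mem_Icc.2 hab)

/-- The velocity and acceleration of a free flight form a linearized flight. -/
theorem IsFreeFlight.isLinearizedFlight {μ a b : ℝ} {r v : ℝ → E3} (h : IsFreeFlight μ a b r v) :
    IsLinearizedFlight μ a b r v (fun t => -((μ / ‖r t‖ ^ 3) • r t)) := fun t ht =>
  ⟨(h t ht).2.2, by
    simpa [Function.comp_def] using
      (hasFDerivAt_gravity μ (h t ht).1).comp_hasDerivWithinAt t (h t ht).2.1⟩

/-! ### A flow for the equations of motion near given arcs. -/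

/-- `φ` is a flow that, on the open set `U` and for times up to `B`, moves along free flights and
depends on time and initial state in a `C¹` way. -/
structure IsFlightFlow (μ B : ℝ) (U : Set (E3 × E3)) (φ : E3 × E3 → ℝ → E3 × E3) : Prop where
  isOpen : IsOpen U
  init : ∀ x, φ x 0 = x
  continuous : Continuous fun p : (E3 × E3) × ℝ => φ p.1 p.2
  isFreeFlight : ∀ {a b x}, b - a ≤ B → (∀ s ∈ Icc 0 (b - a), φ x s ∈ U) →
    IsFreeFlight μ a b (fun t => (φ x (t - a)).1) (fun t => (φ x (t - a)).2)
  eq_of_isFreeFlight : ∀ {a b r v}, b - a ≤ B → IsFreeFlight μ a b r v →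
    (∀ t ∈ Icc a b, (r t, v t) ∈ U) → ∀ t ∈ Icc a b, φ (r a, v a) (t - a) = (r t, v t)
  eventually_mem : ∀ {x T}, 0 ≤ T → (∀ t ∈ Icc 0 T, φ x t ∈ U) →
    ∀ᶠ p : ℝ × (E3 × E3) in 𝓝 (T, x), ∀ t ∈ Icc 0 p.1, φ p.2 t ∈ U
  hasStrictFDerivAt : ∀ {a b r v}, a < b → b - a < B → IsFreeFlight μ a b r v →
    (∀ t ∈ Icc a b, (r t, v t) ∈ U) → ∃ L : E3 × E3 →L[ℝ] E3 × E3,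
      HasStrictFDerivAt (fun p : ℝ × (E3 × E3) => φ p.2 p.1)
        ((ContinuousLinearMap.toSpanSingleton ℝ (flightField μ (r b, v b))).coprod L)
        (b - a, (r a, v a)) ∧
      ∀ ξ, ∃ ρ ν, IsLinearizedFlight μ a b r ρ ν ∧ (ρ a, ν a) = ξ ∧ (ρ b, ν b) = L ξ

/-- The truncated field has a global flow, and its orbits are true free flights while they stay in
`U`. As the equations are autonomous, one flow serves both arcs of the interceptor and the target.
-/
theorem exists_isFlightFlow (μ : ℝ) {B : ℝ} (hB : 0 ≤ B) {C : Set (E3 × E3)} (hC : IsCompact C)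
    (hC0 : ∀ x ∈ C, x.1 ≠ 0) : ∃ U φ, C ⊆ U ∧ IsFlightFlow μ B U φ := by
  obtain ⟨f, U, hf, hfc, hU, hCU, hU0, hfU⟩ :=
    exists_contDiff_hasCompactSupport_eqOn hC isOpen_fst_ne_zero hC0 (contDiffOn_flightField μ)
  obtain ⟨K, hK⟩ := ContDiff.lipschitzWith_of_hasCompactSupport hfc hf one_ne_zero
  obtain ⟨M, hM⟩ := hfc.exists_bound_of_continuous hf.continuous
  obtain ⟨φ, hφ⟩ := exists_isForwardFlow hK
    (L := ⟨M, (norm_nonneg _).trans (hM 0)⟩) hM hB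
  have hfd : ∀ x, HasFDerivAt f (fderiv ℝ f x) x := fun x =>
    (hf.differentiable one_ne_zero x).hasFDerivAt
  have hfdc : Continuous (fderiv ℝ f) := hf.continuous_fderiv one_ne_zero
  have hfdu : UniformContinuous (fderiv ℝ f) := (hfc.fderiv ℝ).uniformContinuous_of_continuous hfdc
  have hfdU : ∀ x ∈ U, fderiv ℝ f x = linearizedField μ x.1 := fun x hx => by
    have h : f =ᶠ[𝓝 x] flightField μ := by
      filter_upwards [hU.mem_nhds hx] with y hy using hfU hy
    exact h.fderiv_eq.trans (hasFDerivAt_flightField μ (hU0 hx)).fderiv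
  have hmaps : ∀ {a b : ℝ}, b - a ≤ B → MapsTo (fun t => t - a) (Icc a b) (Icc 0 B) :=
    fun h t ht => ⟨by linarith [ht.1], by linarith [ht.2]⟩
  have huniq : ∀ {a b r v}, b - a ≤ B → IsFreeFlight μ a b r v →
      (∀ t ∈ Icc a b, (r t, v t) ∈ U) → ∀ t ∈ Icc a b, φ (r a, v a) (t - a) = (r t, v t) := by
    intro a b r v hab h hmem
    refine hφ.eq_of_hasDerivWithinAt hK hab (x := fun t => (r t, v t)) fun t ht => ?_
    rw [hfU (hmem t ht)]
    exact h.hasDerivWithinAt t ht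
  refine ⟨U, φ, hCU, hU, hφ.init, hφ.continuous, ?_, huniq, hφ.eventually_mem hU, ?_⟩
  · intro a b x hab hx t ht
    have hmem := hx (t - a) ⟨by linarith [ht.1], by linarith [ht.2]⟩
    have hd := (hφ.deriv x (t - a) (hmaps hab ht)).scomp t
      ((hasDerivWithinAt_id t _).sub_const a) (hmaps hab)
    rw [hfU hmem, one_smul] at hd
    exact ⟨hU0 hmem, hasDerivWithinAt_prodMk_iff.1 hd⟩
  · intro a b r v hab hbB h hmem
    -- The variational equation `Φ' = f'(φ) ∘ Φ` is a linear equation on the space of operators, so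
    -- the linear existence theorem applies to it.
    have hA : ContinuousOn (fun t => ContinuousLinearMap.compL ℝ (E3 × E3) (E3 × E3) (E3 × E3)
        (fderiv ℝ f (φ (r a, v a) t))) (Icc 0 B) :=
      ((ContinuousLinearMap.compL ℝ (E3 × E3) (E3 × E3) (E3 × E3)).continuous.comp
        (hfdc.comp (hφ.continuous_apply _))).continuousOn
    obtain ⟨Φ, hΦ0, hΦ⟩ := exists_hasDerivWithinAt_linear hB hA
      (ContinuousLinearMap.id ℝ (E3 × E3))
    have hfin := huniq hbB.le h hmem b (right_mem_Icc.2 hab.le)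
    have hstrict := hφ.hasStrictFDerivAt hfd hfdu hK hΦ0 hΦ
      (T := b - a) ⟨sub_pos.2 hab, hbB⟩
    rw [hfin, hfU (hmem b (right_mem_Icc.2 hab.le))] at hstrict
    refine ⟨Φ (b - a), hstrict, fun ξ => ⟨fun t => (Φ (t - a) ξ).1, fun t => (Φ (t - a) ξ).2,
      fun t ht => ?_, by simp [hΦ0], rfl⟩⟩
    have hd := ((hΦ (t - a) (hmaps hbB.le ht)).clm_apply
      (hasDerivWithinAt_const (t - a) (Icc 0 B) ξ)).scomp t
      ((hasDerivWithinAt_id t _).sub_const a) (hmaps hbB.le)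
    rw [huniq hbB.le h hmem t ht, hfdU _ (hmem t ht)] at hd
    refine hasDerivWithinAt_prodMk_iff.1 (hd.congr_deriv ?_)
    simp [linearizedField]

/-! ### The second impulse strictly precedes the impact. -/

/-- On a one-point interval the derivative conditions are vacuous, so an arc of zero length may
carry any velocity. -/
theorem isFreeFlight_self {μ a : ℝ} {r v : ℝ → E3} (hr : r a ≠ 0) : IsFreeFlight μ a a r v := by
  intro t ht
  obtain rfl : t = a := by simpa using ht
  rw [Icc_self]
  exact ⟨hr, hasDerivWithinAt_iff_hasFDerivWithinAt.2 .singleton,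
    hasDerivWithinAt_iff_hasFDerivWithinAt.2 .singleton⟩

/-- A locally optimal plan does not waste a second impulse at the time of impact. -/
theorem IsLocalOptimum.t1_lt_th {D : InterceptionData} {P : Plan} (hopt : IsLocalOptimum D P)
    (hdv1 : P.dv1 ≠ 0) : P.t1 < P.th := by
  obtain ⟨⟨rM1, vM1, rM2, vM2, rT, vT, h⟩, ε, hε, hmin⟩ := hopt
  refine h.t1_le_th.lt_of_ne fun heq => ?_
  have hn : 0 < ‖P.dv1‖ := norm_pos_iff.2 hdv1
  obtain ⟨s, hs0, hs1, hsε⟩ : ∃ s : ℝ, 0 < s ∧ s ≤ 1 ∧ s * ‖P.dv1‖ < ε := by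
    refine ⟨min 1 (ε / (2 * ‖P.dv1‖)), by positivity, min_le_left _ _, ?_⟩
    calc min 1 (ε / (2 * ‖P.dv1‖)) * ‖P.dv1‖ ≤ ε / (2 * ‖P.dv1‖) * ‖P.dv1‖ := by
          gcongr
          exact min_le_right _ _
      _ = ε / 2 := by field_simp
      _ < ε := by linarith
  have hr1 : rM2 P.t1 ≠ 0 := (h.flight_M2 P.t1 (left_mem_Icc.2 h.t1_le_th)).1
  -- If `t₁ = t_h` the velocity after the second impulse does not affect the interception, so `Δv₁`
  -- can be scaled by `1 - s`, which lowers the cost.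
  have hfeas : IsFeasible D ⟨P.dv0, (1 - s) • P.dv1, P.t1, P.th⟩ :=
    ⟨rM1, vM1, rM2, fun _ => vM1 P.t1 + (1 - s) • P.dv1, rT, vT,
      { h with
        flight_M2 := by
          change IsFreeFlight D.μ P.t1 P.th _ _
          rw [← heq]
          exact isFreeFlight_self hr1
        vM_t1 := rfl }⟩
  have hle := hmin _ hfeas (by simpa using hε) (by
    have : (1 - s) • P.dv1 - P.dv1 = -(s • P.dv1) := by module
    rw [this, norm_neg, norm_smul, Real.norm_of_nonneg hs0.le]
    exact hsε) (by simpa using hε) (by simpa using hε)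
  simp only [Plan.cost, norm_smul, Real.norm_of_nonneg (sub_nonneg.2 hs1)] at hle
  nlinarith

/-! ### The miss vector and its first variation. -/

/-- `d` is the first-order change of the miss vector under the first-order changes
`a0, a1, s1, sh` of the plan. -/
def IsMissVariation (D : InterceptionData) (P : Plan) (rM1 rM2 vM2 vT : ℝ → E3)
    (a0 a1 : E3) (s1 sh : ℝ) (d : E3) : Prop :=
  ∃ ρ1 ν1 ρ2 ν2 : ℝ → E3,
    IsLinearizedFlight D.μ D.t0 P.t1 rM1 ρ1 ν1 ∧
    IsLinearizedFlight D.μ P.t1 P.th rM2 ρ2 ν2 ∧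
    ρ1 D.t0 = 0 ∧ ν1 D.t0 = a0 ∧
    ρ2 P.t1 = ρ1 P.t1 - s1 • P.dv1 ∧ ν2 P.t1 = ν1 P.t1 + a1 ∧
    ρ2 P.th + sh • (vM2 P.th - vT P.th) = d

/-- For every vector `l` there are costates that represent the component along `l` of the
variations of the miss vector. -/
theorem IsInterception.exists_costates {D : InterceptionData} {P : Plan}
    {rM1 vM1 rM2 vM2 rT vT : ℝ → E3} (h : IsInterception D P rM1 vM1 rM2 vM2 rT vT) (l : E3) :
    ∃ pr1 pv1 pr2 pv2 : ℝ → E3,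
      IsCostate D.μ D.t0 P.t1 rM1 pr1 pv1 ∧ IsCostate D.μ P.t1 P.th rM2 pr2 pv2 ∧
      pr1 P.t1 = pr2 P.t1 ∧ pv1 P.t1 = pv2 P.t1 ∧ pr2 P.th = l ∧ pv2 P.th = 0 ∧
      ∀ a0 a1 s1 sh d, IsMissVariation D P rM1 rM2 vM2 vT a0 a1 s1 sh d →
        inner ℝ l d = inner ℝ (pv1 D.t0) a0 + inner ℝ (pv1 P.t1) a1 -
          s1 * inner ℝ (pr1 P.t1) P.dv1 + sh * inner ℝ l (vM2 P.th - vT P.th) := by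
  obtain ⟨pr2, pv2, hp2, hr2, hv2⟩ := exists_isCostate (μ := D.μ) h.t1_le_th
    (continuous_fst.comp_continuousOn h.flight_M2.continuousOn)
    (fun t ht => (h.flight_M2 t ht).1) l 0
  obtain ⟨pr1, pv1, hp1, hr1, hv1⟩ := exists_isCostate (μ := D.μ) h.t0_le_t1
    (continuous_fst.comp_continuousOn h.flight_M1.continuousOn)
    (fun t ht => (h.flight_M1 t ht).1) (pr2 P.t1) (pv2 P.t1)
  refine ⟨pr1, pv1, pr2, pv2, hp1, hp2, hr1, hv1, hr2, hv2, ?_⟩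
  rintro a0 a1 s1 sh d ⟨ρ1, ν1, ρ2, ν2, hl1, hl2, h1, h2, h3, h4, rfl⟩
  -- Conservation of the pairing on each arc. The terminal data `(l, 0)` isolate the position change
  -- at `t_h`, and continuity of the costates at `t₁` joins the two identities.
  have e1 := hp1.inner_add_inner_eq h.t0_le_t1 hl1
  have e2 := hp2.inner_add_inner_eq h.t1_le_th hl2
  rw [h1, h2, inner_zero_right] at e1
  rw [h3, h4, hr2, hv2, ← hr1, ← hv1, inner_zero_left, inner_sub_right, inner_add_right,
    real_inner_smul_right] at e2
  rw [inner_add_right, real_inner_smul_right]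
  linarith

/-- The state of the interceptor just after the second impulse, for the parameters
`(Δv₀, Δv₁, t₁, t_h)`. -/
def stateAfterImpulse (D : InterceptionData) (φ : E3 × E3 → ℝ → E3 × E3)
    (q : E3 × E3 × ℝ × ℝ) : E3 × E3 :=
  φ (D.rM0, D.vM0 + q.1) (q.2.2.1 - D.t0) + (0, q.2.1)

/-- The miss vector as a function of `(Δv₀, Δv₁, t₁, t_h)`. -/
def missVector (D : InterceptionData) (φ : E3 × E3 → ℝ → E3 × E3) (q : E3 × E3 × ℝ × ℝ) : E3 :=
  (φ (stateAfterImpulse D φ q) (q.2.2.2 - q.2.2.1)).1 - (φ (D.rT0, D.vT0) (q.2.2.2 - D.t0)).1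

/-- The parameters of a plan. -/
def Plan.params (P : Plan) : E3 × E3 × ℝ × ℝ := (P.dv0, P.dv1, P.t1, P.th)

section

variable {D : InterceptionData} {P : Plan} {rM1 vM1 rM2 vM2 rT vT : ℝ → E3} {B : ℝ}
  {U : Set (E3 × E3)} {φ : E3 × E3 → ℝ → E3 × E3}

theorem IsInterception.stateAfterImpulse_eq (h : IsInterception D P rM1 vM1 rM2 vM2 rT vT)
    (hφ : IsFlightFlow D.μ B U φ) (hB : P.th - D.t0 ≤ B)
    (hM1 : ∀ t ∈ Icc D.t0 P.t1, (rM1 t, vM1 t) ∈ U) :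
    stateAfterImpulse D φ P.params = (rM2 P.t1, vM2 P.t1) := by
  have hle := h.t1_le_th
  have h1 := hφ.eq_of_isFreeFlight (by linarith) h.flight_M1 hM1 P.t1 (right_mem_Icc.2 h.t0_le_t1)
  rw [h.rM_init, h.vM_init] at h1
  simp [stateAfterImpulse, Plan.params, h1, h.rM_t1, h.vM_t1]

theorem IsInterception.missVector_eq_zero (h : IsInterception D P rM1 vM1 rM2 vM2 rT vT)
    (hφ : IsFlightFlow D.μ B U φ) (hB : P.th - D.t0 ≤ B)
    (hM1 : ∀ t ∈ Icc D.t0 P.t1, (rM1 t, vM1 t) ∈ U)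
    (hM2 : ∀ t ∈ Icc P.t1 P.th, (rM2 t, vM2 t) ∈ U)
    (hT : ∀ t ∈ Icc D.t0 P.th, (rT t, vT t) ∈ U) : missVector D φ P.params = 0 := by
  have hle := h.t1_le_th
  have hle0 := h.t0_le_t1
  have h2 := hφ.eq_of_isFreeFlight (by linarith) h.flight_M2 hM2 P.th (right_mem_Icc.2 hle)
  have h3 := hφ.eq_of_isFreeFlight hB h.flight_T hT P.th (right_mem_Icc.2 (hle0.trans hle))
  rw [h.rT_init, h.vT_init] at h3
  rw [missVector, h.stateAfterImpulse_eq hφ hB hM1]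
  simp only [Plan.params, h2, h3, h.impact]

/-- Near a realized plan, every zero of the miss vector is a feasible plan. -/
theorem IsInterception.eventually_isFeasible (h : IsInterception D P rM1 vM1 rM2 vM2 rT vT)
    (hφ : IsFlightFlow D.μ B U φ) (hB : P.th - D.t0 < B) (ht1 : D.t0 < P.t1) (hth : P.t1 < P.th)
    (hM1 : ∀ t ∈ Icc D.t0 P.t1, (rM1 t, vM1 t) ∈ U)
    (hM2 : ∀ t ∈ Icc P.t1 P.th, (rM2 t, vM2 t) ∈ U)
    (hT : ∀ t ∈ Icc D.t0 P.th, (rT t, vT t) ∈ U) :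
    ∀ᶠ q : E3 × E3 × ℝ × ℝ in 𝓝 P.params, missVector D φ q = 0 →
      IsFeasible D ⟨q.1, q.2.1, q.2.2.1, q.2.2.2⟩ := by
  have hmem : ∀ {a b : ℝ} {r v : ℝ → E3}, b - a ≤ B → IsFreeFlight D.μ a b r v →
      (∀ t ∈ Icc a b, (r t, v t) ∈ U) → ∀ t ∈ Icc 0 (b - a), φ (r a, v a) t ∈ U := by
    intro a b r v hab hfl hU t ht
    have hta : t + a ∈ Icc a b := ⟨by linarith [ht.1], by linarith [ht.2]⟩
    have := hφ.eq_of_isFreeFlight hab hfl hU (t + a) hta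
    rw [add_sub_cancel_right] at this
    exact this ▸ hU _ hta
  have c1 : Continuous fun q : E3 × E3 × ℝ × ℝ => (q.2.2.1 - D.t0, (D.rM0, D.vM0 + q.1)) := by
    fun_prop
  have cs : Continuous (stateAfterImpulse D φ) :=
    (hφ.continuous.comp (continuous_swap.comp c1)).add (by fun_prop)
  have c2 : Continuous fun q : E3 × E3 × ℝ × ℝ =>
      (q.2.2.2 - q.2.2.1, stateAfterImpulse D φ q) :=
    Continuous.prodMk (by fun_prop) cs
  have c3 : Continuous fun q : E3 × E3 × ℝ × ℝ => (q.2.2.2 - D.t0, (D.rT0, D.vT0)) := by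
    fun_prop
  have m1 := hmem (by linarith) h.flight_M1 hM1
  have m2 := hmem (by linarith) h.flight_M2 hM2
  have m3 := hmem hB.le h.flight_T hT
  rw [h.rM_init, h.vM_init] at m1
  rw [h.rT_init, h.vT_init] at m3
  rw [← h.stateAfterImpulse_eq hφ hB.le hM1] at m2
  have e1 := (c1.tendsto P.params).eventually (hφ.eventually_mem (sub_pos.2 ht1).le m1)
  have e2 := (c2.tendsto P.params).eventually (hφ.eventually_mem (sub_pos.2 hth).le m2)
  have e3 := (c3.tendsto P.params).eventually
    (hφ.eventually_mem (sub_pos.2 (ht1.trans hth)).le m3)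
  have e4 : ∀ᶠ q : E3 × E3 × ℝ × ℝ in 𝓝 P.params, D.t0 < q.2.2.1 :=
    (by fun_prop : Continuous fun q : E3 × E3 × ℝ × ℝ => q.2.2.1).continuousAt.eventually
      (lt_mem_nhds ht1)
  have e5 : ∀ᶠ q : E3 × E3 × ℝ × ℝ in 𝓝 P.params, 0 < q.2.2.2 - q.2.2.1 :=
    (by fun_prop : Continuous fun q : E3 × E3 × ℝ × ℝ => q.2.2.2 - q.2.2.1).continuousAt.eventually
      (lt_mem_nhds (sub_pos.2 hth))
  have e6 : ∀ᶠ q : E3 × E3 × ℝ × ℝ in 𝓝 P.params, q.2.2.2 - D.t0 < B :=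
    (by fun_prop : Continuous fun q : E3 × E3 × ℝ × ℝ => q.2.2.2 - D.t0).continuousAt.eventually
      (gt_mem_nhds hB)
  filter_upwards [e1, e2, e3, e4, e5, e6] with q h1 h2 h3 h4 h5 h6 hq
  refine ⟨_, _, _, _, _, _,
    { t0_le_t1 := h4.le
      t1_le_th := (sub_pos.1 h5).le
      flight_M1 := hφ.isFreeFlight (by linarith) h1
      flight_M2 := hφ.isFreeFlight (by linarith) h2
      flight_T := hφ.isFreeFlight h6.le h3
      rM_init := ?_
      vM_init := ?_
      rM_t1 := ?_
      vM_t1 := ?_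
      rT_init := ?_
      vT_init := ?_
      impact := hq }⟩ <;> simp [hφ.init, stateAfterImpulse]

/-- The parameters of a locally optimal plan minimize the cost locally on the zero set of the miss
vector. -/
theorem IsInterception.isLocalMinOn (h : IsInterception D P rM1 vM1 rM2 vM2 rT vT)
    (hopt : IsLocalOptimum D P)
    (hφ : IsFlightFlow D.μ B U φ) (hB : P.th - D.t0 < B) (ht1 : D.t0 < P.t1) (hth : P.t1 < P.th)
    (hM1 : ∀ t ∈ Icc D.t0 P.t1, (rM1 t, vM1 t) ∈ U)
    (hM2 : ∀ t ∈ Icc P.t1 P.th, (rM2 t, vM2 t) ∈ U)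
    (hT : ∀ t ∈ Icc D.t0 P.th, (rT t, vT t) ∈ U) :
    IsLocalMinOn (fun q : E3 × E3 × ℝ × ℝ => ‖q.1‖ + ‖q.2.1‖)
      -- The constraint is written as a level set through the base point, the form used by the
      -- Lagrange rule.
      {q | missVector D φ q = missVector D φ P.params} P.params := by
  obtain ⟨-, ε, hε, hmin⟩ := hopt
  have hfeas := h.eventually_isFeasible hφ hB ht1 hth hM1 hM2 hT
  rw [h.missVector_eq_zero hφ hB.le hM1 hM2 hT]
  have hclose : ∀ g : E3 × E3 × ℝ × ℝ → ℝ, Continuous g → g P.params = 0 →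
      ∀ᶠ q in 𝓝 P.params, g q < ε := fun g hg hg0 =>
    hg.continuousAt.eventually (gt_mem_nhds (hg0.trans_lt hε))
  refine eventually_nhdsWithin_iff.2 ?_
  filter_upwards [hfeas, hclose (fun q => ‖q.1 - P.dv0‖) (by fun_prop) (by simp [Plan.params]),
    hclose (fun q => ‖q.2.1 - P.dv1‖) (by fun_prop) (by simp [Plan.params]),
    hclose (fun q => |q.2.2.1 - P.t1|) (by fun_prop) (by simp [Plan.params]),
    hclose (fun q => |q.2.2.2 - P.th|) (by fun_prop) (by simp [Plan.params])]
    with q hq h1 h2 h3 h4 hq0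
  exact hmin ⟨q.1, q.2.1, q.2.2.1, q.2.2.2⟩ (hq hq0) h1 h2 h3 h4

/-- The miss vector is strictly differentiable; its derivative is computed from the linearized
equations of motion. -/
theorem IsInterception.exists_hasStrictFDerivAt_missVector
    (h : IsInterception D P rM1 vM1 rM2 vM2 rT vT)
    (hφ : IsFlightFlow D.μ B U φ) (hB : P.th - D.t0 < B) (ht1 : D.t0 < P.t1) (hth : P.t1 < P.th)
    (hM1 : ∀ t ∈ Icc D.t0 P.t1, (rM1 t, vM1 t) ∈ U)
    (hM2 : ∀ t ∈ Icc P.t1 P.th, (rM2 t, vM2 t) ∈ U)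
    (hT : ∀ t ∈ Icc D.t0 P.th, (rT t, vT t) ∈ U) :
    ∃ F' : E3 × E3 × ℝ × ℝ →L[ℝ] E3, HasStrictFDerivAt (missVector D φ) F' P.params ∧
      ∀ a0 a1 s1 sh, IsMissVariation D P rM1 rM2 vM2 vT a0 a1 s1 sh (F' (a0, a1, s1, sh)) := by
  obtain ⟨L1, hL1, hlin1⟩ := hφ.hasStrictFDerivAt ht1 (by linarith) h.flight_M1 hM1
  obtain ⟨L2, hL2, hlin2⟩ := hφ.hasStrictFDerivAt hth (by linarith) h.flight_M2 hM2
  obtain ⟨L3, hL3, -⟩ := hφ.hasStrictFDerivAt (ht1.trans hth) hB h.flight_T hT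
  rw [h.rM_init, h.vM_init] at hL1
  rw [h.rT_init, h.vT_init] at hL3
  rw [← h.stateAfterImpulse_eq hφ hB.le hM1] at hL2
  have p0 : HasStrictFDerivAt (fun q : E3 × E3 × ℝ × ℝ => q.1)
    (ContinuousLinearMap.fst ℝ E3 (E3 × ℝ × ℝ)) P.params := hasStrictFDerivAt_fst
  have ps : HasStrictFDerivAt (fun q : E3 × E3 × ℝ × ℝ => q.2)
    (ContinuousLinearMap.snd ℝ E3 (E3 × ℝ × ℝ)) P.params := hasStrictFDerivAt_snd
  have p1 := ps.fst
  have p2 := ps.snd.fst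
  have p3 := ps.snd.snd
  have d1 := hL1.comp P.params
    ((p2.sub_const D.t0).prodMk ((hasStrictFDerivAt_const D.rM0 _).prodMk (p0.const_add D.vM0)))
  have ds := d1.add ((hasStrictFDerivAt_const (0 : E3) _).prodMk p1)
  have d2 := hL2.comp P.params ((p3.sub p2).prodMk ds)
  have d3 := hL3.comp P.params
    ((p3.sub_const D.t0).prodMk (hasStrictFDerivAt_const (D.rT0, D.vT0) _))
  refine ⟨_, d2.fst.sub d3.fst, fun a0 a1 s1 sh => ?_⟩
  obtain ⟨ρ1, ν1, hl1, hi1, hf1⟩ := hlin1 (0, a0)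
  obtain ⟨ρ2, ν2, hl2, hi2, hf2⟩ := hlin2 (s1 • flightField D.μ (rM1 P.t1, vM1 P.t1) +
    L1 (0, a0) + (0, a1))
  rw [Prod.mk.injEq] at hi1
  rw [← hf1] at hi2
  have hv := h.flight_M2.isLinearizedFlight
  -- The flow derivative follows the second arc from its moving start `t₁`. Subtracting `s1` times
  -- the linearized flight (velocity, acceleration) gives the variation at fixed time; at `t₁` the
  -- velocities leave `-s1 • P.dv1`, while the accelerations cancel because position is continuous.
  refine ⟨ρ1, ν1, fun t => ρ2 t - s1 • vM2 t,
    fun t => ν2 t - s1 • -((D.μ / ‖rM2 t‖ ^ 3) • rM2 t), hl1, fun t ht => ?_, hi1.1, hi1.2,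
    ?_, ?_, ?_⟩
  · have hsub := ((hl2 t ht).1.fun_sub ((hv t ht).1.fun_const_smul s1))
    have hsub2 := ((hl2 t ht).2.fun_sub ((hv t ht).2.fun_const_smul s1))
    refine ⟨hsub, hsub2.congr_deriv ?_⟩
    simp only [← gravityGradientL_apply, map_sub, map_smul]
  · have := congrArg Prod.fst hi2
    simp only [flightField, Prod.fst_add, Prod.smul_fst, add_zero] at this
    simp only [this, h.vM_t1]
    module
  · have := congrArg Prod.snd hi2
    simp only [flightField, Prod.snd_add, Prod.smul_snd] at this
    simp only [this, h.rM_t1]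
    module
  · have := congrArg Prod.fst hf2
    simp only at this
    simp only [this]
    generalize flightField D.μ (rM1 P.t1, vM1 P.t1) = f1
    simp [flightField, -map_add]
    module

end

/-! ### Multiplier rule and conclusion. -/

/-- The multiplier rule for a locally optimal plan: the first-order change of the cost is a linear
function of the first-order change of the miss vector. -/
theorem IsInterception.exists_multiplier {D : InterceptionData} {P : Plan}
    {rM1 vM1 rM2 vM2 rT vT : ℝ → E3} (h : IsInterception D P rM1 vM1 rM2 vM2 rT vT)
    (hopt : IsLocalOptimum D P) (hreg : IsRegularInterception D P rM1 rM2 vM2 vT)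
    (ht1 : D.t0 < P.t1) (hdv0 : P.dv0 ≠ 0) (hdv1 : P.dv1 ≠ 0) :
    ∃ l : E3, ∀ a0 a1 s1 sh, ∃ d, IsMissVariation D P rM1 rM2 vM2 vT a0 a1 s1 sh d ∧
      inner ℝ l d + (inner ℝ (‖P.dv0‖⁻¹ • P.dv0) a0 + inner ℝ (‖P.dv1‖⁻¹ • P.dv1) a1) = 0 := by
  have hth := hopt.t1_lt_th hdv1
  set C : Set (E3 × E3) := (fun t => (rM1 t, vM1 t)) '' Icc D.t0 P.t1 ∪
    ((fun t => (rM2 t, vM2 t)) '' Icc P.t1 P.th ∪ (fun t => (rT t, vT t)) '' Icc D.t0 P.th)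
  have hC : IsCompact C := (isCompact_Icc.image_of_continuousOn h.flight_M1.continuousOn).union
    ((isCompact_Icc.image_of_continuousOn h.flight_M2.continuousOn).union
      (isCompact_Icc.image_of_continuousOn h.flight_T.continuousOn))
  have hC0 : ∀ x ∈ C, x.1 ≠ 0 := by
    rintro x (⟨t, ht, rfl⟩ | ⟨t, ht, rfl⟩ | ⟨t, ht, rfl⟩)
    exacts [(h.flight_M1 t ht).1, (h.flight_M2 t ht).1, (h.flight_T t ht).1]
  -- The extra unit of time puts all flight durations in the interior of `[0, B]`, where two-sided
  -- time derivatives exist.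
  obtain ⟨U, φ, hCU, hφ⟩ := exists_isFlightFlow D.μ (B := P.th - D.t0 + 1) (by linarith) hC hC0
  have hM1 : ∀ t ∈ Icc D.t0 P.t1, (rM1 t, vM1 t) ∈ U := fun t ht =>
    hCU (Or.inl (mem_image_of_mem _ ht))
  have hM2 : ∀ t ∈ Icc P.t1 P.th, (rM2 t, vM2 t) ∈ U := fun t ht =>
    hCU (Or.inr (Or.inl (mem_image_of_mem _ ht)))
  have hT : ∀ t ∈ Icc D.t0 P.th, (rT t, vT t) ∈ U := fun t ht =>
    hCU (Or.inr (Or.inr (mem_image_of_mem _ ht)))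
  have hB : P.th - D.t0 < P.th - D.t0 + 1 := lt_add_one _
  obtain ⟨F', hF', hvar⟩ := h.exists_hasStrictFDerivAt_missVector hφ hB ht1 hth hM1 hM2 hT
  have hmin := h.isLocalMinOn hopt hφ hB ht1 hth hM1 hM2 hT
  have p0 : HasStrictFDerivAt (fun q : E3 × E3 × ℝ × ℝ => q.1)
    (ContinuousLinearMap.fst ℝ E3 (E3 × ℝ × ℝ)) P.params := hasStrictFDerivAt_fst
  have ps : HasStrictFDerivAt (fun q : E3 × E3 × ℝ × ℝ => q.2)
    (ContinuousLinearMap.snd ℝ E3 (E3 × ℝ × ℝ)) P.params := hasStrictFDerivAt_snd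
  have hJ := ((hasStrictFDerivAt_norm_of_ne_zero hdv0).comp P.params p0).add
    ((hasStrictFDerivAt_norm_of_ne_zero hdv1).comp P.params ps.fst)
  obtain ⟨Λ, Λ₀, hne, hΛ⟩ :=
    IsLocalExtrOn.exists_linear_map_of_hasStrictFDerivAt (Or.inl hmin) hF' hJ
  set l : E3 := (InnerProductSpace.toDual ℝ E3).symm (LinearMap.toContinuousLinearMap Λ)
  have hl : ∀ d, inner ℝ l d = Λ d := fun d => by simp [l]
  have hid : ∀ a0 a1 s1 sh, inner ℝ l (F' (a0, a1, s1, sh)) +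
      Λ₀ * (inner ℝ (‖P.dv0‖⁻¹ • P.dv0) a0 + inner ℝ (‖P.dv1‖⁻¹ • P.dv1) a1) = 0 := by
    intro a0 a1 s1 sh
    have := hΛ (a0, a1, s1, sh)
    rw [← hl] at this
    simpa [real_inner_smul_left] using this
  -- If `Λ₀ = 0`, then `l` annihilates the range of `F'`. Regularity gives a variation with miss
  -- change `l`; by the costate formula `⟪l, d⟫` depends only on the variation of the plan, so `⟪l,
  -- l⟫ = 0` and both multipliers vanish.
  have hΛ₀ : Λ₀ ≠ 0 := by
    rintro rfl
    obtain ⟨pr1, pv1, pr2, pv2, -, -, -, -, -, -, hrep⟩ := h.exists_costates l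
    have hl0 : l = 0 := by
      refine inner_self_eq_zero (𝕜 := ℝ).1 ?_
      obtain ⟨a0, a1, s1, sh, hd⟩ := hreg l
      rw [hrep a0 a1 s1 sh l hd, ← hrep a0 a1 s1 sh _ (hvar a0 a1 s1 sh)]
      simpa using hid a0 a1 s1 sh
    refine hne (Prod.ext (LinearMap.ext fun d => ?_) rfl)
    simp [← hl, hl0]
  refine ⟨Λ₀⁻¹ • l, fun a0 a1 s1 sh => ⟨_, hvar a0 a1 s1 sh, ?_⟩⟩
  rw [real_inner_smul_left, ← mul_right_inj' hΛ₀, mul_add, mul_inv_cancel_left₀ hΛ₀, mul_zero]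
  exact hid a0 a1 s1 sh

theorem mainTheorem1 (D : InterceptionData) (hμ : 0 < D.μ) (P : Plan)
    (rM1 vM1 rM2 vM2 rT vT : ℝ → E3)
    (htraj : IsInterception D P rM1 vM1 rM2 vM2 rT vT)
    (hopt : IsLocalOptimum D P)
    (hreg : IsRegularInterception D P rM1 rM2 vM2 vT)
    (ht1 : D.t0 < P.t1) (hdv0 : P.dv0 ≠ 0) (hdv1 : P.dv1 ≠ 0) :
    ∃ pMr1 pMv1 pMr2 pMv2 : ℝ → E3,
      IsCostate D.μ D.t0 P.t1 rM1 pMr1 pMv1 ∧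
      IsCostate D.μ P.t1 P.th rM2 pMr2 pMv2 ∧
      pMv1 D.t0 + ‖P.dv0‖⁻¹ • P.dv0 = 0 ∧
      pMv1 P.t1 + ‖P.dv1‖⁻¹ • P.dv1 = 0 ∧
      pMv1 P.t1 - pMv2 P.t1 = 0 ∧
      pMv2 P.th = 0 ∧
      pMr1 P.t1 - pMr2 P.t1 = 0 ∧
      -inner ℝ (pMr1 P.t1) P.dv1 = 0 ∧
      inner ℝ (pMr2 P.th) (vM2 P.th - vT P.th) = 0 := by
  obtain ⟨l, hl⟩ := htraj.exists_multiplier hopt hreg ht1 hdv0 hdv1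
  obtain ⟨pr1, pv1, pr2, pv2, hp1, hp2, hr, hv, hrh, hvh, hrep⟩ := htraj.exists_costates l
  -- Stationarity in costate form; testing with one nonzero variation at a time isolates each
  -- coefficient.
  have key : ∀ a0 a1 s1 sh, inner ℝ (pv1 D.t0 + ‖P.dv0‖⁻¹ • P.dv0) a0 +
      inner ℝ (pv1 P.t1 + ‖P.dv1‖⁻¹ • P.dv1) a1 - s1 * inner ℝ (pr1 P.t1) P.dv1 +
        sh * inner ℝ l (vM2 P.th - vT P.th) = 0 := by
    intro a0 a1 s1 sh
    obtain ⟨d, hd, hd0⟩ := hl a0 a1 s1 sh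
    rw [hrep a0 a1 s1 sh d hd] at hd0
    rw [inner_add_left, inner_add_left]
    linarith
  refine ⟨pr1, pv1, pr2, pv2, hp1, hp2, ?_, ?_, sub_eq_zero.2 hv, hvh, sub_eq_zero.2 hr, ?_, ?_⟩
  · refine inner_self_eq_zero (𝕜 := ℝ).1 ?_
    simpa using key (pv1 D.t0 + ‖P.dv0‖⁻¹ • P.dv0) 0 0 0
  · refine inner_self_eq_zero (𝕜 := ℝ).1 ?_
    simpa using key 0 (pv1 P.t1 + ‖P.dv1‖⁻¹ • P.dv1) 0 0
  · simpa using key 0 0 1 0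
  · rw [hrh]
    simpa using key 0 0 0 1
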